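/- A polygonal domain $\mathcal P\subset\mathbb R^2$ is a compact connected set that is the closure of its interior and whose boundary consists of $h+1$ pairwise disjoint simple closed polygonal chains, $h\ge 0$; its set $V$ of corners is the set of points at which these chains turn. The geodesic distance $\mathrm d(p,q)$ of $p,q\in\mathcal P$ is the length of a shortest polygonal path from $p$ to $q$ inside $\mathcal P$, and $q\in\mathcal P$ is a farthest neighbor of $p$ if $\mathrm d(p,q)=\max_{x\in\mathcal P}\mathrm d(p,x)$. For $s\in\mathcal P$ and $v\in V\cup\{s\}$ let $\sigma_s(v)$ be the set of $t\in\mathcal P$ that are reached from $s$ by a shortest path $(s,v_1,\dots,v_k,t)$ with $v_1,\dots,v_k\in V$ whose last corner $v_k$ is $v$ (for $v=s$, $k=0$ is allowed, and the path is then the segment $\overline{st}$). The faces of the shortest path map $\mathsf{SPM}(s)$ are the interiors of the cells $\sigma_s(v)$, and its edges inside $\mathcal P$ are the common boundaries, in the interior of $\mathcal P$, of two faces belonging to distinct $v,w\in V\cup\{s\}$. The vertices of $\mathsf{SPM}(s)$ are the corners of $\mathcal P$, the points of $\partial\mathcal P$ in the closure of such an edge, and the points in the closures of at least three faces. Lemma.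 For every polygonal domain $\mathcal P$ and every point $p\in\mathcal P$, every farthest neighbor of $p$ in $\mathcal P$ is a vertex of $\mathsf{SPM}(p)$. -/

import Mathlib

open Set

/-- The Euclidean plane. -/
abbrev Plane := EuclideanSpace ℝ (Fin 2)

/-- A simple closed polygonal chain with `k + 3` vertices, in cyclic order (indices are taken
modulo `k + 3`).  Non-adjacent edges are disjoint and the chain makes a genuine turn at each
vertex; in particular adjacent edges share only their common endpoint.  Points at which the chain
runs straight on are not listed as vertices. -/
structure SimplePolygon where
  k : ℕ
  vertex : Fin (k + 3) → Plane
  turn : ∀ i, ¬ Collinear ℝ {vertex i, vertex (i + 1), vertex (i + 2)}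
  disjoint_edges : ∀ i j, i ≠ j → j ≠ i + 1 → i ≠ j + 1 →
    Disjoint (segment ℝ (vertex i) (vertex (i + 1))) (segment ℝ (vertex j) (vertex (j + 1)))

/-- The closed polygonal curve traced by a simple polygon. -/
def SimplePolygon.curve (C : SimplePolygon) : Set Plane :=
  ⋃ i, segment ℝ (C.vertex i) (C.vertex (i + 1))

/-- A polygonal domain with `holes` holes: a compact connected planar region (a set that is the
closure of its interior) whose boundary consists of `holes + 1` pairwise disjoint simple closed
polygonal chains. -/
structure PolygonalDomain where
  carrier : Set Plane
  holes : ℕ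
  chain : Fin (holes + 1) → SimplePolygon
  isCompact : IsCompact carrier
  isConnected : IsConnected carrier
  closure_interior : closure (interior carrier) = carrier
  frontier_eq : frontier carrier = ⋃ i, (chain i).curve
  disjoint_chains : ∀ i j, i ≠ j → Disjoint (chain i).curve (chain j).curve

/-- The length of the polygonal path through the listed points. -/
noncomputable def polyLength : List Plane → ℝ
  | [] => 0
  | [_] => 0
  | a :: b :: l => dist a b + polyLength (b :: l)

namespace PolygonalDomain

/-- The set `V` of corners of the domain. -/
def corners (P : PolygonalDomain) : Set Plane :=
  {x | ∃ i j, x = (P.chain i).vertex j}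

/-- The polygonal path through the listed points stays inside the domain. -/
def IsFeasible (P : PolygonalDomain) (l : List Plane) : Prop :=
  l.IsChain (fun a b => segment ℝ a b ⊆ P.carrier)

/-- The geodesic distance: the infimum of the lengths of the polygonal paths
`s, x₁, …, xₖ, t` inside the domain. -/
noncomputable def geodesicDist (P : PolygonalDomain) (s t : Plane) : ℝ :=
  sInf {r | ∃ l : List Plane, P.IsFeasible (s :: (l ++ [t])) ∧ r = polyLength (s :: (l ++ [t]))}

/-- `q` is a farthest neighbor of `p`: it maximizes the geodesic distance from `p` over the
domain. -/
def IsFarthestNeighbor (P : PolygonalDomain) (p q : Plane) : Prop :=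
  q ∈ P.carrier ∧ ∀ x ∈ P.carrier, P.geodesicDist p x ≤ P.geodesicDist p q

/-- The set `V ∪ {s}`, which indexes the cells of the shortest path map of `s`. -/
def sites (P : PolygonalDomain) (s : Plane) : Set Plane := insert s P.corners

/-- `c` is the corner sequence of a shortest path `s, c₁, …, cₖ, t` from `s` to `t`
(`k = 0` is allowed: the path is then the segment from `s` to `t`). -/
def IsShortestVia (P : PolygonalDomain) (s t : Plane) (c : List Plane) : Prop :=
  (∀ x ∈ c, x ∈ P.corners) ∧ P.IsFeasible (s :: (c ++ [t])) ∧
    polyLength (s :: (c ++ [t])) = P.geodesicDist s t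

/-- The (closed) cell `σ_s(v)`: the points reached from `s` by a shortest path whose last corner
is `v`; for `v = s` the points reached by a straight segment from `s`. -/
def cell (P : PolygonalDomain) (s v : Plane) : Set Plane :=
  {t | ∃ c : List Plane, P.IsShortestVia s t c ∧ c.getLastD s = v}

/-- The two-dimensional face of the shortest path map of `s` that belongs to `v`. -/
def face (P : PolygonalDomain) (s v : Plane) : Set Plane := interior (P.cell s v)

/-- The edge between the faces of `v` and `w`: the points inside the domain on the common
boundary of these two faces. -/
def edge (P : PolygonalDomain) (s v w : Plane) : Set Plane :=
  closure (P.face s v) ∩ closure (P.face s w) ∩ interior P.carrier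

/-- The vertices of the shortest path map of `s`: the corners of the domain, the endpoints on the
boundary of the domain of the edges between two faces, and the points incident to at least three
faces. -/
def spmVertices (P : PolygonalDomain) (s : Plane) : Set Plane :=
  {q | q ∈ P.corners ∨
    (q ∈ frontier P.carrier ∧
      ∃ v ∈ P.sites s, ∃ w ∈ P.sites s, v ≠ w ∧ q ∈ closure (P.edge s v w)) ∨
    (∃ u ∈ P.sites s, ∃ v ∈ P.sites s, ∃ w ∈ P.sites s, u ≠ v ∧ u ≠ w ∧ v ≠ w ∧
      q ∈ closure (P.face s u) ∧ q ∈ closure (P.face s v) ∧ q ∈ closure (P.face s w))}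

end PolygonalDomain

/-! ### Polygonal paths -/

/-! Let `q` be farthest from `p` and not a corner. Near `q` the domain is covered by the closures of
the faces accumulating at `q`, and on the face of `v` the geodesic distance is a constant plus the
Euclidean distance to `v`. As `q` is a maximum, each nearby point is no farther than `q` from some
incident site, so every feasible direction `d` at `q` has an incident `v` with `0 < inner ℝ d (v -
q)` (`IsFarthestNeighbor.exists_inner_pos`). In the interior, some direction has nonpositive inner
product with `v - q` and `w - q` for any two given sites, so three faces meet at `q`. On a boundary
edge, one of the two directions along the edge does this for any single site, so two faces meet at
`q`. If only two do, the interior near `q` is connected, by local convexity, and the edge between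
them accumulates at `q` (`mem_closure_edge`).

This needs finitely many closed cells covering the domain, hence shortest paths that turn at corners
only (`exists_isShortestVia`), although `geodesicDist` is an infimum over all polygonal paths.
`HasCornerPath.extend` slides an endpoint along a segment while keeping all inner vertices at
corners; after cutting loops, finitely many candidates remain. The geometric input is that the
domain is locally star-shaped everywhere (`exists_ball_starShaped`) and locally convex off the
corners (`exists_ball_convex`). -/

theorem polyLength_nonneg : ∀ l : List Plane, 0 ≤ polyLength l
  | [] => le_rfl
  | [_] => le_rfl
  | _ :: b :: l => add_nonneg dist_nonneg (polyLength_nonneg (b :: l))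

/-- Splits off the last edge. The default `s` in `getLastD` covers a path without inner vertices,
whose only edge starts at `s`. -/
theorem polyLength_cons_concat (s t : Plane) (c : List Plane) :
    polyLength (s :: (c ++ [t])) = polyLength (s :: c) + dist (c.getLastD s) t := by
  induction c generalizing s with
  | nil => simp [polyLength]
  | cons a c ih =>
    rw [List.cons_append, polyLength, ih a, polyLength, List.getLastD_cons, add_assoc]

theorem polyLength_le_append : ∀ l₁ l₂ : List Plane, polyLength l₂ ≤ polyLength (l₁ ++ l₂)
  | [], _ => le_rfl
  | a :: [], [] => le_rfl
  | a :: [], b :: l => by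
    simp only [List.cons_append, List.nil_append, polyLength]
    linarith [dist_nonneg (x := a) (y := b)]
  | a :: b :: l₁, l₂ => by
    have := polyLength_le_append (b :: l₁) l₂
    simp only [List.cons_append, polyLength] at this ⊢
    linarith [dist_nonneg (x := a) (y := b)]

theorem List.mem_of_getLastD_ne {α : Type*} {c : List α} {s v : α} (h : c.getLastD s = v)
    (hv : v ≠ s) : v ∈ c := by
  induction c generalizing s with
  | nil => exact absurd h.symm hv
  | cons a c ih =>
    rw [List.getLastD_cons] at h
    by_cases hva : v = a
    · simp [hva]
    · exact List.mem_cons_of_mem _ (ih h hva)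

/-- The length of such a list is at most the cardinality of `S`. This finiteness turns infima over
corner paths into minima and makes unions over them closed. -/
theorem Set.Finite.finite_nodup_lists {α : Type*} {S : Set α} (hS : S.Finite) :
    {c : List α | c.Nodup ∧ ∀ x ∈ c, x ∈ S}.Finite := by
  classical
  have := hS.to_subtype
  have := Fintype.ofFinite S
  refine ((List.finite_length_le S (Fintype.card S)).image (List.map Subtype.val)).subset ?_
  rintro c ⟨hn, hc⟩
  lift c to List S using hc
  exact ⟨c, (hn.of_map _).length_le_card, rfl⟩

namespace PolygonalDomain

variable (P : PolygonalDomain)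

theorem isFeasible_cons_cons {a b : Plane} {l : List Plane} :
    P.IsFeasible (a :: b :: l) ↔ segment ℝ a b ⊆ P.carrier ∧ P.IsFeasible (b :: l) :=
  List.isChain_cons_cons

theorem isFeasible_cons_concat {s t : Plane} {c : List Plane} :
    P.IsFeasible (s :: (c ++ [t])) ↔
      P.IsFeasible (s :: c) ∧ segment ℝ (c.getLastD s) t ⊆ P.carrier := by
  induction c generalizing s with
  | nil => simp [IsFeasible]
  | cons a c ih =>
    rw [List.cons_append, isFeasible_cons_cons, ih, isFeasible_cons_cons, List.getLastD_cons,
      and_assoc]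

variable {P}

theorem IsFeasible.of_append {l₁ l₂ : List Plane} (h : P.IsFeasible (l₁ ++ l₂)) :
    P.IsFeasible l₂ :=
  List.IsChain.right_of_append h

theorem geodesicDist_nonneg (s t : Plane) : 0 ≤ P.geodesicDist s t := by
  refine Real.sInf_nonneg ?_
  rintro _ ⟨l, _, rfl⟩
  exact polyLength_nonneg _

theorem geodesicDist_le {s t : Plane} {l : List Plane} (h : P.IsFeasible (s :: (l ++ [t]))) :
    P.geodesicDist s t ≤ polyLength (s :: (l ++ [t])) := by
  refine csInf_le ⟨0, ?_⟩ ⟨l, h, rfl⟩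
  rintro _ ⟨l, _, rfl⟩
  exact polyLength_nonneg _

theorem geodesicDist_self {s : Plane} (hs : s ∈ P.carrier) : P.geodesicDist s s = 0 := by
  refine le_antisymm ?_ (geodesicDist_nonneg s s)
  have h : P.IsFeasible (s :: ([] ++ [s])) := by
    simpa [IsFeasible] using hs
  simpa [polyLength] using geodesicDist_le h

theorem exists_nodup_path {s t : Plane} {c : List Plane} (hc : P.IsFeasible (s :: (c ++ [t]))) :
    ∃ c' : List Plane, c'.Nodup ∧ c' ⊆ c ∧ P.IsFeasible (s :: (c' ++ [t])) ∧
      polyLength (s :: (c' ++ [t])) ≤ polyLength (s :: (c ++ [t])) := by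
  induction c generalizing s with
  | nil => exact ⟨[], List.nodup_nil, List.Subset.refl _, hc, le_rfl⟩
  | cons a c ih =>
    rw [List.cons_append, isFeasible_cons_cons] at hc
    obtain ⟨c', hn, hsub, hf, hl⟩ := ih hc.2
    -- If `a` is visited again, the loop is cut by continuing from the later visit.
    by_cases ha : a ∈ c'
    · obtain ⟨u, v, rfl⟩ := List.append_of_mem ha
      refine ⟨a :: v, hn.of_append_right, ?_, ?_, ?_⟩
      · exact fun x hx => List.mem_cons_of_mem _ (hsub (List.mem_append_right _ hx))
      · rw [List.cons_append, isFeasible_cons_cons]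
        refine ⟨hc.1, IsFeasible.of_append (l₁ := a :: u) ?_⟩
        simpa using hf
      · have := polyLength_le_append (a :: u) (a :: (v ++ [t]))
        simp only [List.append_assoc, List.cons_append] at hl this
        simp only [List.cons_append, polyLength]
        linarith
    · refine ⟨a :: c', List.nodup_cons.2 ⟨ha, hn⟩, List.cons_subset_cons _ hsub, ?_, ?_⟩
      · rw [List.cons_append, isFeasible_cons_cons]
        exact ⟨hc.1, hf⟩
      · simp only [List.cons_append, polyLength]
        linarith

theorem finite_corners (P : PolygonalDomain) : P.corners.Finite := by
  refine (Set.finite_range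
    fun x : Σ i : Fin (P.holes + 1), Fin ((P.chain i).k + 3) => (P.chain x.1).vertex x.2).subset ?_
  rintro x ⟨i, j, rfl⟩
  exact ⟨⟨i, j⟩, rfl⟩

theorem finite_sites (P : PolygonalDomain) (s : Plane) : (P.sites s).Finite :=
  P.finite_corners.insert s

end PolygonalDomain

/-! ### The local structure of a polygonal domain -/

section Segments

variable {E : Type*} [NormedAddCommGroup E] [NormedSpace ℝ E]

theorem isClosed_real_segment (A B : E) : IsClosed (segment ℝ A B) := by
  rw [segment_eq_image']
  exact (isCompact_Icc.image (by fun_prop)).isClosed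

/-- Near each of its points, a segment is a union of initial pieces of rays. -/
theorem exists_ball_segment_conic (A B x : E) :
    ∃ r > 0, ∀ y ∈ Metric.ball x r, ∀ k : ℝ, 0 < k → k ≤ 1 → x + k • (y - x) ∈ segment ℝ A B →
      x ∈ segment ℝ A B ∧ y ∈ segment ℝ A B := by
  by_cases hx : x ∈ segment ℝ A B
  · have hx' := hx
    rw [segment_eq_image'] at hx
    obtain ⟨s, hs, rfl⟩ := hx
    by_cases hAB : A = B
    · subst hAB
      refine ⟨1, one_pos, fun y _ k hk _ h => ⟨hx', ?_⟩⟩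
      simp only [sub_self, smul_zero, add_zero, segment_same, mem_singleton_iff,
        add_eq_left, smul_eq_zero, hk.ne', false_or] at h ⊢
      exact sub_eq_zero.1 h
    have hd : 0 < ‖B - A‖ := norm_pos_iff.2 (sub_ne_zero.2 (Ne.symm hAB))
    -- In parameter units, `ρ` is at most the distance from `s` to each end of the segment other
    -- than `x` itself.
    obtain ⟨ρ, hρ, h0, h1⟩ : ∃ ρ > 0, (0 < s → ρ ≤ s) ∧ (s < 1 → ρ ≤ 1 - s) := by
      rcases hs.1.eq_or_lt with h | h
      · exact ⟨1, one_pos, fun h' => by linarith, fun _ => by linarith⟩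
      rcases hs.2.eq_or_lt with h' | h'
      · exact ⟨s, h, fun _ => le_rfl, fun _ => by linarith⟩
      · exact ⟨min s (1 - s), lt_min h (by linarith), fun _ => min_le_left _ _,
          fun _ => min_le_right _ _⟩
    refine ⟨ρ * ‖B - A‖, by positivity, fun y hy k hk _ h => ⟨hx', ?_⟩⟩
    rw [segment_eq_image'] at h ⊢
    obtain ⟨s', hs', h⟩ := h
    simp only at h hy
    set m := (s' - s) / k with hm
    have hyx : y - (A + s • (B - A)) = m • (B - A) := by
      have h2 : k • (y - (A + s • (B - A))) = (s' - s) • (B - A) := by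
        rw [sub_smul, eq_sub_iff_add_eq, add_comm]
        have := h.symm
        rw [add_assoc] at this
        exact add_left_cancel this
      rw [hm, div_eq_inv_mul, mul_smul, ← h2, smul_smul, inv_mul_cancel₀ hk.ne', one_smul]
    have hmlt : |m| < ρ := by
      rw [mem_ball_iff_norm, hyx, norm_smul, Real.norm_eq_abs] at hy
      exact lt_of_mul_lt_mul_right hy hd.le
    have hmk : m * k = s' - s := div_mul_cancel₀ _ hk.ne'
    have hmb := abs_lt.1 hmlt
    refine ⟨s + m, ⟨?_, ?_⟩, ?_⟩
    · by_cases hm0 : 0 ≤ m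
      -- The sign of `m` tells towards which end `y` lies. If `m < 0`, then `0 ≤ s' = s + m * k`
      -- forces `0 < s`, so that `ρ ≤ s` is available; the other end is symmetric.
      · linarith [hs.1]
      · have : 0 < s := by nlinarith [hs'.1]
        linarith [h0 this]
    · by_cases hm0 : m ≤ 0
      · linarith [hs.2]
      · have : s < 1 := by nlinarith [hs'.2]
        linarith [h1 this]
    · simp only
      rw [sub_eq_iff_eq_add] at hyx
      rw [hyx, add_smul]
      abel
  · obtain ⟨r, hr, hb⟩ :=
      Metric.isOpen_iff.1 (isClosed_real_segment A B).isOpen_compl x hx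
    refine ⟨r, hr, fun y hy k hk hk1 h => absurd h (hb ?_)⟩
    rw [mem_ball_iff_norm] at hy ⊢
    rw [add_sub_cancel_left, norm_smul, Real.norm_of_nonneg hk.le]
    nlinarith [norm_nonneg (y - x)]

/-- A second common point would put both segments on one line through `B`. -/
theorem eq_of_mem_segment_of_not_collinear {A B C x : E} (h : ¬ Collinear ℝ {A, B, C})
    (h₁ : x ∈ segment ℝ A B) (h₂ : x ∈ segment ℝ B C) : x = B := by
  rw [segment_symm, segment_eq_image'] at h₁
  rw [segment_eq_image'] at h₂
  obtain ⟨u, _, rfl⟩ := h₁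
  obtain ⟨v, _, huv⟩ := h₂
  by_cases hu : u = 0
  · simp [hu]
  refine absurd ?_ h
  rw [collinear_iff_of_mem (p₀ := B) (by simp)]
  refine ⟨C - B, fun p hp => ?_⟩
  rcases hp with rfl | rfl | rfl
  · refine ⟨u⁻¹ * v, ?_⟩
    have huv' : v • (C - B) = u • (p - B) := add_left_cancel huv
    rw [mul_smul, huv', smul_smul, inv_mul_cancel₀ hu, one_smul, vadd_eq_add, sub_add_cancel]
  · exact ⟨0, by simp⟩
  · exact ⟨1, by simp⟩

theorem IsPreconnected.subset_or_subset_of_disjoint_frontier {X : Type*} [TopologicalSpace X]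
    {s K : Set X} (hs : IsPreconnected s) (h : Disjoint s (frontier K)) :
    s ⊆ interior K ∨ s ⊆ (closure K)ᶜ := by
  refine hs.subset_or_subset isOpen_interior isClosed_closure.isOpen_compl
    (disjoint_compl_right.mono_left interior_subset_closure) fun x hx => ?_
  by_contra hx'
  rw [mem_union, not_or, notMem_compl_iff] at hx'
  exact disjoint_left.1 h hx ⟨hx'.2, hx'.1⟩

end Segments

/-- Near an inner point of a segment that makes up the frontier, a closed planar set is convex. -/
theorem exists_ball_convex_of_frontier_subset {K : Set Plane} (hK : IsClosed K) {A B x : Plane}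
    (hAB : A ≠ B) (hx : x ∈ openSegment ℝ A B) (hsub : segment ℝ A B ⊆ frontier K) {r : ℝ}
    (hr : 0 < r) (hF : frontier K ∩ Metric.ball x r ⊆ segment ℝ A B) :
    ∃ r > 0, Convex ℝ (K ∩ Metric.ball x r) := by
  rw [openSegment_eq_image'] at hx
  obtain ⟨s, hs, hsx⟩ := hx
  simp only at hsx
  set d := B - A with hd
  have hd0 : d ≠ 0 := sub_ne_zero.2 (Ne.symm hAB)
  -- The kernel of `f` is the direction of the segment, so the sign of `f z - f x` tells the side of
  -- the line on which `z` lies.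
  let f : Plane →L[ℝ] ℝ := d 0 • EuclideanSpace.proj (1 : Fin 2) - d 1 • EuclideanSpace.proj (0 : Fin 2)
  have hf : ∀ z, f z = d 0 * z 1 - d 1 * z 0 := fun z => by simp [f]
  have hlin : IsLinearMap ℝ f := f.toLinearMap.isLinear
  have hker : ∀ z, f z = 0 → ∃ m : ℝ, z = m • d := by
    intro z hz
    rw [hf] at hz
    by_cases h0 : d 0 = 0
    · have h1 : d 1 ≠ 0 := fun h1 => hd0 (by ext i; fin_cases i <;> simp [h0, h1])
      refine ⟨z 1 / d 1, ?_⟩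
      ext i
      fin_cases i
      · have : z 0 = 0 := by
          rw [h0, zero_mul, zero_sub, neg_eq_zero] at hz
          exact (mul_eq_zero.1 hz).resolve_left h1
        simp [this, h0]
      · simp [h1]
    · refine ⟨z 0 / d 0, ?_⟩
      ext i
      fin_cases i
      · simp [h0]
      · simp only [Fin.mk_one, PiLp.smul_apply, smul_eq_mul]
        field_simp
        linarith
  have hfd : f d = 0 := by rw [hf]; ring
  have hseg : ∀ z ∈ segment ℝ A B, f z = f x := by
    intro z hz
    rw [segment_eq_image'] at hz
    obtain ⟨t, _, rfl⟩ := hz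
    simp only [← hsx, ← hd, map_add, map_smul, hfd, smul_zero]
  have hdn : 0 < ‖d‖ := norm_pos_iff.2 hd0
  set ρ := min r (min s (1 - s) * ‖d‖) with hρdef
  have hm : 0 < min s (1 - s) := lt_min hs.1 (by linarith [hs.2])
  have hρ : 0 < ρ := lt_min hr (by positivity)
  have hline : ∀ z ∈ Metric.ball x ρ, f z = f x → z ∈ segment ℝ A B := by
    intro z hz hfz
    obtain ⟨m, hm'⟩ := hker (z - x) (by rw [map_sub, hfz, sub_self])
    rw [mem_ball_iff_norm, hm', norm_smul, Real.norm_eq_abs] at hz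
    have := abs_lt.1 (lt_of_mul_lt_mul_right (hz.trans_le (min_le_right _ _)) hdn.le)
    have h1 := min_le_left s (1 - s)
    have h2 := min_le_right s (1 - s)
    rw [segment_eq_image']
    refine ⟨s + m, ⟨by linarith, by linarith⟩, ?_⟩
    rw [sub_eq_iff_eq_add] at hm'
    simp only
    rw [hm', ← hsx, ← hd, add_smul]
    abel
  have hfr : ∀ z ∈ Metric.ball x ρ, z ∈ frontier K → f z = f x := fun z hz hzF =>
    hseg z (hF ⟨hzF, Metric.ball_subset_ball (min_le_left _ _) hz⟩)
  have hlineK : ∀ z ∈ Metric.ball x ρ, f z = f x → z ∈ K := fun z hz h =>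
    hK.frontier_subset (hsub (hline z hz h))
  -- Each open half-disk is connected and misses the frontier, so it lies entirely inside or
  -- entirely outside `K`.
  have hside : ∀ S : Set Plane, Convex ℝ S → (∀ z ∈ S, f z ≠ f x) →
      S ∩ Metric.ball x ρ ⊆ K ∨ S ∩ Metric.ball x ρ ⊆ Kᶜ := by
    intro S hS hne
    rcases (hS.inter (convex_ball x ρ)).isPreconnected.subset_or_subset_of_disjoint_frontier
      (K := K) (disjoint_left.2 fun z hz hzF => hne z hz.1 (hfr z hz.2 hzF)) with h | h
    · exact Or.inl (h.trans interior_subset)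
    · exact Or.inr (h.trans (compl_subset_compl.2 subset_closure))
  have hpos := hside {z | f x < f z} (convex_halfSpace_gt hlin _) fun z hz => ne_of_gt hz
  have hneg := hside {z | f z < f x} (convex_halfSpace_lt hlin _) fun z hz => ne_of_lt hz
  refine ⟨ρ, hρ, ?_⟩
  have key : ∀ S : Set Plane, Convex ℝ S → (∀ z ∈ Metric.ball x ρ, z ∈ K ↔ z ∈ S) →
      Convex ℝ (K ∩ Metric.ball x ρ) := by
    intro S hS h
    have : K ∩ Metric.ball x ρ = S ∩ Metric.ball x ρ := by
      ext z
      exact ⟨fun hz => ⟨(h z hz.2).1 hz.1, hz.2⟩, fun hz => ⟨(h z hz.2).2 hz.1, hz.2⟩⟩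
    rw [this]
    exact hS.inter (convex_ball x ρ)
  -- The four cases give the disk, two closed half-disks and a chord, all convex.
  rcases hpos with hp | hp <;> rcases hneg with hn | hn
  · refine key univ convex_univ fun z hz => ⟨fun _ => trivial, fun _ => ?_⟩
    rcases lt_trichotomy (f z) (f x) with h | h | h
    exacts [hn ⟨h, hz⟩, hlineK z hz h, hp ⟨h, hz⟩]
  · refine key {z | f x ≤ f z} (convex_halfSpace_ge hlin _) fun z hz => ⟨fun h => ?_, fun h => ?_⟩
    · exact not_lt.1 fun h' : f z < f x => hn ⟨h', hz⟩ h
    · rcases (show f x ≤ f z from h).eq_or_lt with h | h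
      exacts [hlineK z hz h.symm, hp ⟨h, hz⟩]
  · refine key {z | f z ≤ f x} (convex_halfSpace_le hlin _) fun z hz => ⟨fun h => ?_, fun h => ?_⟩
    · exact not_lt.1 fun h' : f x < f z => hp ⟨h', hz⟩ h
    · rcases (show f z ≤ f x from h).eq_or_lt with h | h
      exacts [hlineK z hz h, hn ⟨h, hz⟩]
  · refine key {z | f z = f x} (convex_hyperplane hlin _) fun z hz => ⟨fun h => ?_, hlineK z hz⟩
    rcases lt_trichotomy (f z) (f x) with h' | h' | h'
    exacts [absurd h (hn ⟨h', hz⟩), h', absurd h (hp ⟨h', hz⟩)]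

namespace PolygonalDomain

variable (P : PolygonalDomain)

theorem isClosed_carrier : IsClosed P.carrier := P.isCompact.isClosed

theorem frontier_subset : frontier P.carrier ⊆ P.carrier := P.isClosed_carrier.frontier_subset

/-- The edges of the boundary chains, indexed by chain and position. -/
def boundaryEdge (e : Σ i : Fin (P.holes + 1), Fin ((P.chain i).k + 3)) : Set Plane :=
  segment ℝ ((P.chain e.1).vertex e.2) ((P.chain e.1).vertex (e.2 + 1))

theorem frontier_eq_iUnion_boundaryEdge : frontier P.carrier = ⋃ e, P.boundaryEdge e := by
  rw [P.frontier_eq]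
  ext x
  simp [SimplePolygon.curve, boundaryEdge]

theorem boundaryEdge_subset (e) : P.boundaryEdge e ⊆ frontier P.carrier := by
  rw [frontier_eq_iUnion_boundaryEdge]
  exact subset_iUnion _ e

theorem corners_subset : P.corners ⊆ P.carrier := by
  rintro _ ⟨i, j, rfl⟩
  exact P.frontier_subset (P.boundaryEdge_subset ⟨i, j⟩ (left_mem_segment ℝ _ _))

/-- A polygonal domain is locally star-shaped. -/
theorem exists_ball_starShaped {x : Plane} (hx : x ∈ P.carrier) :
    ∃ r > 0, ∀ y ∈ P.carrier, y ∈ Metric.ball x r → segment ℝ x y ⊆ P.carrier := by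
  choose r hr hconic using fun e : Σ i : Fin (P.holes + 1), Fin ((P.chain i).k + 3) =>
    exists_ball_segment_conic ((P.chain e.1).vertex e.2) ((P.chain e.1).vertex (e.2 + 1)) x
  obtain ⟨ρ, hρ, hle⟩ : ∃ ρ > 0, ∀ e, ρ ≤ r e := by
    obtain ⟨e₀, h⟩ := Finite.exists_min r
    exact ⟨r e₀, hr e₀, h⟩
  refine ⟨ρ, hρ, fun y hy hyb z hz => ?_⟩
  by_contra hzP
  have hz' := hz
  rw [segment_eq_image'] at hz
  obtain ⟨k, hk, rfl⟩ := hz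
  have hk0 : 0 < k := hk.1.lt_of_ne (by rintro rfl; simp [hx] at hzP)
  -- Between a point outside the domain and `y` there is a frontier point. By the choice of `ρ`, the
  -- boundary edge through it contains both `x` and `y`, hence the allegedly missing point.
  have hnd : ¬ Disjoint (segment ℝ (x + k • (y - x)) y) (frontier P.carrier) := by
    intro hdis
    rcases (convex_segment _ _).isPreconnected.subset_or_subset_of_disjoint_frontier hdis with h | h
    · exact hzP (interior_subset (h (left_mem_segment ℝ _ _)))
    · exact h (right_mem_segment ℝ _ _) (subset_closure hy)
  obtain ⟨f, hf, hfF⟩ := not_disjoint_iff.1 hnd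
  rw [frontier_eq_iUnion_boundaryEdge, mem_iUnion] at hfF
  obtain ⟨e, he⟩ := hfF
  rw [segment_eq_image'] at hf
  obtain ⟨m, hm, rfl⟩ := hf
  have heq : x + k • (y - x) + m • (y - (x + k • (y - x))) = x + (k + m * (1 - k)) • (y - x) := by
    module
  simp only [heq] at he
  obtain ⟨h1, h2⟩ := hconic e y (Metric.ball_subset_ball (hle e) hyb) _
    (by nlinarith [hk.2, hm.1]) (by nlinarith [hk.2, hm.2]) he
  exact hzP (P.frontier_subset (P.boundaryEdge_subset e
    ((convex_segment _ _).segment_subset h1 h2 hz')))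

theorem boundaryEdge_disjoint_outside_corners {e e' : Σ i : Fin (P.holes + 1), Fin ((P.chain i).k + 3)}
    (hne : e ≠ e') {x : Plane} (hx : x ∈ P.boundaryEdge e) (hx' : x ∈ P.boundaryEdge e') :
    x ∈ P.corners := by
  obtain ⟨i, j⟩ := e
  obtain ⟨i', j'⟩ := e'
  by_cases hi : i = i'
  · subst hi
    have hj : j ≠ j' := fun h => hne (by rw [h])
    have hadj : ∀ a b, b = a + 1 → x ∈ P.boundaryEdge ⟨i, a⟩ → x ∈ P.boundaryEdge ⟨i, b⟩ →
        x ∈ P.corners := by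
      rintro a _ rfl ha hb
      refine ⟨i, a + 1, eq_of_mem_segment_of_not_collinear ((P.chain i).turn a) ha ?_⟩
      have h2 : a + 2 = a + 1 + 1 := by
        rw [add_assoc]
        congr 1
      rw [h2]
      exact hb
    by_cases h1 : j' = j + 1
    · exact hadj _ _ h1 hx hx'
    by_cases h2 : j = j' + 1
    · exact hadj _ _ h2 hx' hx
    exact absurd hx' (disjoint_left.1 ((P.chain i).disjoint_edges j j' hj h1 h2) hx)
  · exact absurd (mem_iUnion.2 ⟨j', hx'⟩)
      (disjoint_left.1 (P.disjoint_chains i i' hi) (mem_iUnion.2 ⟨j, hx⟩))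

/-- A boundary point that is not a corner lies inside an edge, and no other edge is near. -/
theorem exists_edge_of_mem_frontier {x : Plane} (hx : x ∈ frontier P.carrier)
    (hc : x ∉ P.corners) :
    ∃ A B : Plane, A ≠ B ∧ x ∈ openSegment ℝ A B ∧ segment ℝ A B ⊆ frontier P.carrier ∧
      ∃ r > 0, frontier P.carrier ∩ Metric.ball x r ⊆ segment ℝ A B := by
  rw [frontier_eq_iUnion_boundaryEdge, mem_iUnion] at hx
  obtain ⟨e, he⟩ := hx
  have hA : (P.chain e.1).vertex e.2 ≠ x := fun h => hc ⟨e.1, e.2, h.symm⟩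
  have hB : (P.chain e.1).vertex (e.2 + 1) ≠ x := fun h => hc ⟨e.1, _, h.symm⟩
  refine ⟨_, _, ?_, mem_openSegment_of_ne_left_right hA hB he, P.boundaryEdge_subset e, ?_⟩
  · intro h
    rw [boundaryEdge, h, segment_same] at he
    exact hB he.symm
  · have hclosed : IsClosed (⋃ e' : {e' // e' ≠ e}, P.boundaryEdge e'.1) :=
      isClosed_iUnion_of_finite fun e' => isClosed_real_segment _ _
    obtain ⟨r, hr, hball⟩ := Metric.isOpen_iff.1 hclosed.isOpen_compl x fun h => by
      obtain ⟨⟨e', hne⟩, he'⟩ := mem_iUnion.1 h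
      exact hc (P.boundaryEdge_disjoint_outside_corners hne he' he)
    refine ⟨r, hr, fun z hz => ?_⟩
    rw [frontier_eq_iUnion_boundaryEdge] at hz
    obtain ⟨e', he'⟩ := mem_iUnion.1 hz.1
    by_cases h : e' = e
    · exact h ▸ he'
    · exact absurd (mem_iUnion.2 ⟨⟨e', h⟩, he'⟩) (hball hz.2)

/-- Away from its corners, a polygonal domain is locally convex. -/
theorem exists_ball_convex {x : Plane} (hx : x ∈ P.carrier) (hc : x ∉ P.corners) :
    ∃ r > 0, Convex ℝ (P.carrier ∩ Metric.ball x r) := by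
  by_cases hi : x ∈ interior P.carrier
  · obtain ⟨r, hr, h⟩ := Metric.mem_nhds_iff.1 (mem_interior_iff_mem_nhds.1 hi)
    refine ⟨r, hr, ?_⟩
    rw [inter_eq_self_of_subset_right h]
    exact convex_ball x r
  · obtain ⟨A, B, hAB, hxs, hsub, r, hr, hF⟩ :=
      P.exists_edge_of_mem_frontier ⟨subset_closure hx, hi⟩ hc
    exact exists_ball_convex_of_frontier_subset P.isClosed_carrier hAB hxs hsub hr hF

end PolygonalDomain

/-! ### Shortest paths turn at corners only -/

theorem isClosed_setOf_segment_subset {K : Set Plane} (hK : IsClosed K) (v : Plane) :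
    IsClosed {t | segment ℝ v t ⊆ K} := by
  have : {t | segment ℝ v t ⊆ K} = ⋂ θ ∈ Icc (0 : ℝ) 1, (fun t => v + θ • (t - v)) ⁻¹' K := by
    ext t
    rw [mem_ofPred_eq, segment_eq_image', image_subset_iff, mem_iInter₂]
    rfl
  rw [this]
  exact isClosed_biInter fun θ _ => hK.preimage (by fun_prop)

namespace PolygonalDomain

variable {P : PolygonalDomain}

/-- Translating initial pieces of a segment without inner corners along a direction that is
feasible at its first point. -/
theorem exists_translate_subset {w a e : Plane} (hwa : segment ℝ w a ⊆ P.carrier)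
    (hae : segment ℝ a (a + e) ⊆ P.carrier) (hne : w ≠ a)
    (hcor : ∀ x ∈ segment ℝ w a, x ∈ P.corners → x = w) {M : ℝ} (hM : M < 1) :
    ∃ τ > 0, ∀ μ ∈ Icc (0 : ℝ) M, ∀ t ∈ Icc (0 : ℝ) τ,
      a + μ • (w - a) + t • e ∈ P.carrier := by
  set g := w - a with hg
  have hg0 : 0 < ‖g‖ := norm_pos_iff.2 (sub_ne_zero.2 hne)
  have hyseg : ∀ μ ∈ Icc (0 : ℝ) 1, a + μ • g ∈ segment ℝ w a := fun μ hμ => by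
    rw [segment_symm, segment_eq_image']
    exact ⟨μ, hμ, rfl⟩
  -- Continuation in `M`: the width `τ` of the swept strip may shrink, but it has to stay positive
  -- up to every parameter below 1.
  let S : ℝ → Prop := fun M => ∃ τ > 0, ∀ μ ∈ Icc (0 : ℝ) M, ∀ t ∈ Icc (0 : ℝ) τ,
      a + μ • g + t • e ∈ P.carrier
  have hS0 : S 0 := by
    refine ⟨1, one_pos, fun μ hμ t ht => ?_⟩
    have : μ = 0 := le_antisymm hμ.2 hμ.1
    rw [this, zero_smul, add_zero]
    apply hae
    rw [segment_eq_image']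
    exact ⟨t, ht, by simp⟩
  have hstep : ∀ M, 0 ≤ M → M < 1 → ∃ η > 0, M + η < 1 ∧
      ∀ μ₁, 0 ≤ μ₁ → M - η ≤ μ₁ → μ₁ ≤ M → S μ₁ → S (M + η) := by
    intro M hM0 hM1
    obtain ⟨r, hr, hconv⟩ := P.exists_ball_convex (hwa (hyseg M ⟨hM0, hM1.le⟩)) fun hc => by
      have h := hcor _ (hyseg M ⟨hM0, hM1.le⟩) hc
      have h2 : (1 - M) • g = 0 := by
        rw [sub_smul, one_smul, hg, sub_eq_zero, sub_eq_iff_eq_add, ← hg, add_comm]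
        exact h.symm
      rcases smul_eq_zero.1 h2 with h3 | h3
      · linarith
      · exact hg0.ne' (norm_eq_zero.2 h3)
    -- The parameters up to `M + 2 * η` stay below 1 and inside the ball of convexity. The sweep is
    -- claimed up to `M + η` only, which leaves room for a triangle with apex at `M + 2 * η`.
    refine ⟨min ((1 - M) / 2) (r / (4 * ‖g‖)) / 2, ?_, ?_, ?_⟩
    · have : 0 < 1 - M := by linarith
      positivity
    · have := min_le_left ((1 - M) / 2) (r / (4 * ‖g‖))
      linarith
    intro μ₁ hμ₁ hη₁ hμM ⟨τ₁, hτ₁, h₁⟩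
    set η := min ((1 - M) / 2) (r / (4 * ‖g‖)) / 2 with hη
    have hη0 : 0 < η := by
      have : 0 < 1 - M := by linarith
      positivity
    have hηM : M + 2 * η < 1 := by
      have := min_le_left ((1 - M) / 2) (r / (4 * ‖g‖))
      linarith
    have hηr : 2 * η * ‖g‖ ≤ r / 4 := by
      have := min_le_right ((1 - M) / 2) (r / (4 * ‖g‖))
      have h2 : 2 * η ≤ r / (4 * ‖g‖) := by linarith
      calc 2 * η * ‖g‖ ≤ r / (4 * ‖g‖) * ‖g‖ := by gcongr
        _ = r / 4 := by field_simp
    have hball : ∀ μ t : ℝ, |μ - M| ≤ 2 * η → 0 ≤ t → t * ‖e‖ < r / 2 →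
        a + μ • g + t • e ∈ Metric.ball (a + M • g) r := by
      intro μ t hμ ht hte
      have heq : a + μ • g + t • e - (a + M • g) = (μ - M) • g + t • e := by module
      rw [mem_ball_iff_norm, heq]
      calc ‖(μ - M) • g + t • e‖ ≤ ‖(μ - M) • g‖ + ‖t • e‖ := norm_add_le _ _
        _ = |μ - M| * ‖g‖ + t * ‖e‖ := by
          rw [norm_smul, norm_smul, Real.norm_eq_abs, Real.norm_of_nonneg ht]
        _ ≤ 2 * η * ‖g‖ + t * ‖e‖ := by gcongr
        _ < r := by linarith
    set τ := min τ₁ (r / (4 * (‖e‖ + 1))) with hτ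
    have he1 : 0 < ‖e‖ + 1 := by positivity
    have hτ0 : 0 < τ := lt_min hτ₁ (by positivity)
    have hτe : τ * ‖e‖ < r / 2 := by
      have h2 : τ ≤ r / (4 * (‖e‖ + 1)) := min_le_right _ _
      have h3 : τ * (‖e‖ + 1) ≤ r / 4 := by
        calc τ * (‖e‖ + 1) ≤ r / (4 * (‖e‖ + 1)) * (‖e‖ + 1) := by gcongr
          _ = r / 4 := by field_simp
      nlinarith
    have hz : a + μ₁ • g + τ • e ∈ P.carrier ∩ Metric.ball (a + M • g) r :=
      ⟨h₁ μ₁ ⟨hμ₁, le_rfl⟩ τ ⟨hτ0.le, min_le_left _ _⟩,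
        hball _ _ (abs_le.2 ⟨by linarith, by linarith⟩) hτ0.le hτe⟩
    have hpt : ∀ μ, 0 ≤ μ → μ ≤ 1 → |μ - M| ≤ 2 * η →
        a + μ • g ∈ P.carrier ∩ Metric.ball (a + M • g) r := by
      intro μ h0 h1 h
      refine ⟨hwa (hyseg μ ⟨h0, h1⟩), ?_⟩
      simpa using hball μ 0 h le_rfl (by linarith)
    have hA := hpt μ₁ hμ₁ (by linarith) (abs_le.2 ⟨by linarith, by linarith⟩)
    have hB := hpt (M + 2 * η) (by linarith) hηM.le (abs_le.2 ⟨by linarith, by linarith⟩)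
    -- The bounds `θ ≤ 1 / 3` and `β ≤ 2 / 3` keep the third convex weight `1 - θ - β` nonnegative.
    refine ⟨τ / 3, by positivity, fun μ hμ t ht => ?_⟩
    by_cases hle : μ ≤ μ₁
    · exact h₁ μ ⟨hμ.1, hle⟩ t ⟨ht.1, by linarith [ht.2, min_le_left τ₁ (r / (4 * (‖e‖ + 1)))]⟩
    push Not at hle
    set L := M + 2 * η - μ₁ with hL
    have hL0 : 0 < L := by linarith
    set β := (μ - μ₁) / L with hβ
    have hβ0 : 0 ≤ β := div_nonneg (by linarith) hL0.le
    have hβ1 : β ≤ 2 / 3 := by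
      rw [hβ, div_le_iff₀ hL0]
      linarith [hμ.2]
    have hβL : β * L = μ - μ₁ := div_mul_cancel₀ _ hL0.ne'
    set θ := t / τ with hθ
    have hθ0 : 0 ≤ θ := div_nonneg ht.1 hτ0.le
    have hθ1 : θ ≤ 1 / 3 := by
      rw [hθ, div_le_iff₀ hτ0]
      linarith [ht.2]
    have hθτ : θ * τ = t := div_mul_cancel₀ _ hτ0.ne'
    have hcomb := hconv.sum_mem (t := (Finset.univ : Finset (Fin 3)))
      (w := ![1 - θ - β, θ, β])
      (z := ![a + μ₁ • g, a + μ₁ • g + τ • e, a + (M + 2 * η) • g])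
      (by
        intro i _
        fin_cases i
        · exact (by linarith : 0 ≤ 1 - θ - β)
        · exact hθ0
        · exact hβ0)
      (by simp only [Fin.sum_univ_three, Matrix.cons_val]; ring)
      (by
        intro i _
        fin_cases i
        exacts [hA, hz, hB])
    rw [Fin.sum_univ_three] at hcomb
    simp only [Matrix.cons_val] at hcomb
    have heq : a + μ • g + t • e = (1 - θ - β) • (a + μ₁ • g) + θ • (a + μ₁ • g + τ • e)
        + β • (a + (M + 2 * η) • g) := by
      rw [← hθτ, show μ = μ₁ + β * (M + 2 * η - μ₁) by linarith]
      module
    rw [heq]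
    exact hcomb.1
  have hmono : ∀ M M' : ℝ, M' ≤ M → S M → S M' := fun M M' h ⟨τ, hτ, hS⟩ =>
    ⟨τ, hτ, fun μ hμ => hS μ ⟨hμ.1, hμ.2.trans h⟩⟩
  set T := {μ : ℝ | 0 ≤ μ ∧ μ < 1 ∧ S μ} with hT
  have hT0 : (0 : ℝ) ∈ T := ⟨le_rfl, one_pos, hS0⟩
  have hbdd : BddAbove T := ⟨1, fun μ hμ => hμ.2.1.le⟩
  have hsup : ¬ sSup T < 1 := by
    intro h
    have h0 : 0 ≤ sSup T := le_csSup hbdd hT0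
    obtain ⟨η, hη, hη1, hs⟩ := hstep _ h0 h
    obtain ⟨μ₁, hμ₁, hlt⟩ := exists_lt_of_lt_csSup ⟨0, hT0⟩ (sub_lt_self (sSup T) hη)
    have := le_csSup hbdd (show sSup T + η ∈ T from
      ⟨by linarith, hη1, hs μ₁ hμ₁.1 hlt.le (le_csSup hbdd hμ₁) hμ₁.2.2⟩)
    linarith
  obtain ⟨μ₁, hμ₁, hlt⟩ := exists_lt_of_lt_csSup ⟨0, hT0⟩ (hM.trans_le (not_lt.1 hsup))
  exact hmono _ _ hlt.le hμ₁.2.2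

/-- If no corner lies on `[w, a]` except possibly `w`, then from `w` one still sees the points that
are near `a` on a segment starting at `a`. -/
theorem exists_segment_subset_of_near {w a e : Plane} (hwa : segment ℝ w a ⊆ P.carrier)
    (hae : segment ℝ a (a + e) ⊆ P.carrier)
    (hcor : ∀ x ∈ segment ℝ w a, x ∈ P.corners → x = w) :
    ∃ τ₀ > 0, ∀ τ ∈ Icc (0 : ℝ) τ₀, segment ℝ w (a + τ • e) ⊆ P.carrier := by
  by_cases hne : w = a
  · subst hne
    refine ⟨1, one_pos, fun τ hτ => ?_⟩
    have hmem : w + τ • e ∈ segment ℝ w (w + e) := by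
      rw [segment_eq_image']
      exact ⟨τ, hτ, by simp⟩
    intro z hz
    exact hae ((convex_segment w (w + e)).segment_subset (left_mem_segment ℝ _ _) hmem hz)
  -- Since `w` may be a corner, the translation argument stops short of it; the last piece, of
  -- parameter length `δ`, is covered by star-shapedness at `w`.
  obtain ⟨r, hr, hstar⟩ := P.exists_ball_starShaped (hwa (left_mem_segment ℝ _ _))
  set g := w - a with hg
  set δ := min (1 / 2) (r / (2 * (‖g‖ + 1))) with hδ
  have hδ0 : 0 < δ := lt_min (by norm_num) (by positivity)
  have hδ1 : δ ≤ 1 / 2 := min_le_left _ _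
  have hδg : δ * ‖g‖ < r / 2 := by
    have h : δ * (‖g‖ + 1) ≤ r / 2 := by
      calc δ * (‖g‖ + 1) ≤ r / (2 * (‖g‖ + 1)) * (‖g‖ + 1) := by gcongr; exact min_le_right _ _
        _ = r / 2 := by field_simp
    linarith
  obtain ⟨τ₁, hτ₁, htr⟩ := exists_translate_subset hwa hae hne hcor (M := 1 - δ) (by linarith)
  refine ⟨min τ₁ (r / (2 * (‖e‖ + 1))), lt_min hτ₁ (by positivity), fun τ hτ => ?_⟩
  have hττ₁ : τ ≤ τ₁ := hτ.2.trans (min_le_left _ _)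
  have hτe : τ * ‖e‖ ≤ r / 2 := by
    have h : τ * (‖e‖ + 1) ≤ r / 2 := by
      calc τ * (‖e‖ + 1) ≤ r / (2 * (‖e‖ + 1)) * (‖e‖ + 1) := by
            gcongr; exact hτ.2.trans (min_le_right _ _)
        _ = r / 2 := by field_simp
    linarith [hτ.1]
  have hmem : ∀ μ ∈ Icc (0 : ℝ) (1 - δ),
      (a + τ • e) + μ • (w - (a + τ • e)) ∈ P.carrier := by
    intro μ hμ
    have heq : (a + τ • e) + μ • (w - (a + τ • e)) = a + μ • g + ((1 - μ) * τ) • e := by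
      rw [hg]
      module
    rw [heq]
    refine htr μ hμ _ ⟨mul_nonneg (by linarith [hμ.2]) hτ.1, ?_⟩
    nlinarith [hμ.1, hτ.1]
  rw [segment_symm, segment_eq_image']
  rintro _ ⟨μ, hμ, rfl⟩
  by_cases hle : μ ≤ 1 - δ
  · exact hmem μ ⟨hμ.1, hle⟩
  push Not at hle
  have hz := hmem (1 - δ) ⟨by linarith, le_rfl⟩
  refine hstar _ hz ?_ ?_
  · have heq : (a + τ • e) + (1 - δ) • (w - (a + τ • e)) - w = δ • (-g) + (δ * τ) • e := by
      rw [hg]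
      module
    rw [mem_ball_iff_norm, heq]
    calc ‖δ • (-g) + (δ * τ) • e‖ ≤ ‖δ • (-g)‖ + ‖(δ * τ) • e‖ := norm_add_le _ _
      _ = δ * ‖g‖ + δ * (τ * ‖e‖) := by
        rw [norm_smul, norm_smul, norm_neg, Real.norm_of_nonneg hδ0.le,
          Real.norm_of_nonneg (mul_nonneg hδ0.le hτ.1), mul_assoc]
      _ < r := by nlinarith
  · rw [segment_eq_image']
    refine ⟨(1 - μ) / δ, ⟨div_nonneg (by linarith [hμ.2]) hδ0.le,
      (div_le_one hδ0).2 (by linarith)⟩, ?_⟩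
    have h : (1 - μ) / δ * δ = 1 - μ := div_mul_cancel₀ _ hδ0.ne'
    have hμ' : μ = 1 - (1 - μ) / δ * δ := by linarith
    set k := (1 - μ) / δ
    simp only
    rw [hμ']
    module

/-- There is a path from `s` to `t` of length at most `ρ` all of whose inner vertices are
corners. -/
def HasCornerPath (P : PolygonalDomain) (s t : Plane) (ρ : ℝ) : Prop :=
  ∃ c : List Plane, (∀ x ∈ c, x ∈ P.corners) ∧ P.IsFeasible (s :: (c ++ [t])) ∧
    polyLength (s :: (c ++ [t])) ≤ ρ

/-- After cutting loops, only finitely many corner lists matter, and each imposes a closed condition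
on `τ`. -/
theorem isClosed_setOf_hasCornerPath (s a e : Plane) (ρ d : ℝ) :
    IsClosed {τ : ℝ | P.HasCornerPath s (a + τ • e) (ρ + τ * d)} := by
  have heq : {τ : ℝ | P.HasCornerPath s (a + τ • e) (ρ + τ * d)} =
      ⋃ c ∈ {c : List Plane | c.Nodup ∧ ∀ x ∈ c, x ∈ P.corners},
        {τ : ℝ | P.IsFeasible (s :: c) ∧ segment ℝ (c.getLastD s) (a + τ • e) ⊆ P.carrier ∧
          polyLength (s :: c) + dist (c.getLastD s) (a + τ • e) ≤ ρ + τ * d} := by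
    ext τ
    simp only [mem_ofPred_eq, mem_iUnion, exists_prop]
    constructor
    · rintro ⟨c, hc, hf, hl⟩
      obtain ⟨c', hn, hsub, hf', hl'⟩ := exists_nodup_path hf
      rw [isFeasible_cons_concat] at hf'
      rw [polyLength_cons_concat] at hl'
      exact ⟨c', ⟨hn, fun x hx => hc x (hsub hx)⟩, hf'.1, hf'.2, hl'.trans hl⟩
    · rintro ⟨c, ⟨_, hc⟩, hf, hseg, hl⟩
      exact ⟨c, hc, (P.isFeasible_cons_concat).2 ⟨hf, hseg⟩, by rwa [polyLength_cons_concat]⟩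
  rw [heq]
  refine P.finite_corners.finite_nodup_lists.isClosed_biUnion fun c _ => ?_
  refine isClosed_const.and (IsClosed.and ?_ ?_)
  · exact (isClosed_setOf_segment_subset P.isClosed_carrier (c.getLastD s)).preimage
      (by fun_prop : Continuous fun τ : ℝ => a + τ • e)
  · exact isClosed_le (by fun_prop) (by fun_prop)

theorem HasCornerPath.extend_near {s a e : Plane} {ρ : ℝ} (h : P.HasCornerPath s a ρ)
    (hae : segment ℝ a (a + e) ⊆ P.carrier) :
    ∃ τ₀ > 0, ∀ τ ∈ Icc (0 : ℝ) τ₀, P.HasCornerPath s (a + τ • e) (ρ + τ * ‖e‖) := by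
  obtain ⟨c, hc, hf, hl⟩ := h
  rw [isFeasible_cons_concat] at hf
  rw [polyLength_cons_concat] at hl
  obtain ⟨hf, hva⟩ := hf
  set v := c.getLastD s with hv
  -- Taking `w` closest to `a` leaves no other corner on `[w, a]`. As `w` lies on the last edge,
  -- making it a vertex costs no length.
  obtain ⟨w, ⟨hwseg, hwc⟩, hmin⟩ := Set.exists_min_image
    {x | x ∈ segment ℝ v a ∧ (x = v ∨ x ∈ P.corners)} (fun x => dist x a)
    ((P.finite_corners.insert v).subset fun x hx => hx.2) ⟨v, left_mem_segment ℝ _ _, Or.inl rfl⟩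
  have hsub : segment ℝ w a ⊆ segment ℝ v a :=
    (convex_segment v a).segment_subset hwseg (right_mem_segment ℝ _ _)
  have hcor : ∀ x ∈ segment ℝ w a, x ∈ P.corners → x = w := by
    intro x hx hxc
    have h1 := hmin x ⟨hsub hx, Or.inr hxc⟩
    have h2 := dist_add_dist_of_mem_segment hx
    exact (dist_le_zero.1 (by linarith)).symm
  have hvw := dist_add_dist_of_mem_segment hwseg
  obtain ⟨c', hc', hf', hlast, hl'⟩ : ∃ c' : List Plane, (∀ x ∈ c', x ∈ P.corners) ∧
      P.IsFeasible (s :: c') ∧ c'.getLastD s = w ∧ polyLength (s :: c') + dist w a ≤ ρ := by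
    by_cases hwv : w = v
    · exact ⟨c, hc, hf, by rw [hwv], by rwa [hwv]⟩
    · refine ⟨c ++ [w], ?_, ?_, by simp, ?_⟩
      · intro x hx
        rcases List.mem_append.1 hx with hx | hx
        · exact hc x hx
        · rw [List.mem_singleton.1 hx]
          exact hwc.resolve_left hwv
      · refine (P.isFeasible_cons_concat).2 ⟨hf, Subset.trans ?_ hva⟩
        exact (convex_segment v a).segment_subset (left_mem_segment ℝ _ _) hwseg
      · rw [polyLength_cons_concat, ← hv]
        linarith
  obtain ⟨τ₀, hτ₀, h⟩ := exists_segment_subset_of_near (hsub.trans hva) hae hcor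
  refine ⟨τ₀, hτ₀, fun τ hτ => ⟨c', hc', ?_, ?_⟩⟩
  · exact (P.isFeasible_cons_concat).2 ⟨hf', by rw [hlast]; exact h τ hτ⟩
  · rw [polyLength_cons_concat, hlast]
    have h1 : dist w (a + τ • e) ≤ dist w a + dist a (a + τ • e) := dist_triangle _ _ _
    have h2 : dist a (a + τ • e) = τ * ‖e‖ := by
      rw [dist_self_add_right, norm_smul, Real.norm_of_nonneg hτ.1]
    linarith

/-- Continuous induction along `[a, b]`: the good parameters form a closed set, and `extend_near`
moves beyond each of them. -/
theorem HasCornerPath.extend {s a b : Plane} {ρ : ℝ} (h : P.HasCornerPath s a ρ)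
    (hab : segment ℝ a b ⊆ P.carrier) : P.HasCornerPath s b (ρ + dist a b) := by
  set e := b - a with he
  have hsub : Icc (0 : ℝ) 1 ⊆ {τ : ℝ | P.HasCornerPath s (a + τ • e) (ρ + τ * ‖e‖)} := by
    refine IsClosed.Icc_subset_of_forall_exists_gt
      ((isClosed_setOf_hasCornerPath s a e ρ ‖e‖).inter isClosed_Icc) (by simpa using h) ?_
    rintro x ⟨hx, hx01⟩ y hy
    have hsegx : segment ℝ (a + x • e) (a + x • e + (1 - x) • e) ⊆ P.carrier := by
      refine Subset.trans ((convex_segment a b).segment_subset ?_ ?_) hab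
      · rw [segment_eq_image']
        exact ⟨x, ⟨hx01.1, hx01.2.le⟩, rfl⟩
      · have : a + x • e + (1 - x) • e = b := by
          rw [he]
          module
        rw [this]
        exact right_mem_segment ℝ _ _
    obtain ⟨τ₀, hτ₀, hnear⟩ := HasCornerPath.extend_near hx hsegx
    have h1x : 0 < 1 - x := by linarith [hx01.2]
    set t := min τ₀ ((y - x) / (1 - x)) with ht
    have hyx : 0 < y - x := sub_pos.2 hy
    have ht0 : 0 < t := lt_min hτ₀ (by positivity)
    have hty : t * (1 - x) ≤ y - x := by
      have := min_le_right τ₀ ((y - x) / (1 - x))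
      rwa [← le_div_iff₀ h1x]
    refine ⟨x + t * (1 - x), ?_, ⟨by nlinarith, by linarith⟩⟩
    have hcp := hnear t ⟨ht0.le, min_le_left _ _⟩
    rw [norm_smul, Real.norm_of_nonneg h1x.le] at hcp
    have e1 : a + x • e + t • (1 - x) • e = a + (x + t * (1 - x)) • e := by module
    have e2 : ρ + x * ‖e‖ + t * ((1 - x) * ‖e‖) = ρ + (x + t * (1 - x)) * ‖e‖ := by ring
    rw [e1, e2] at hcp
    exact hcp
  have := hsub (right_mem_Icc.2 zero_le_one)
  rw [mem_ofPred_eq, one_smul, one_mul, he, add_sub_cancel, ← dist_eq_norm, dist_comm] at this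
  exact this

theorem IsFeasible.hasCornerPath {s t : Plane} {l : List Plane}
    (h : P.IsFeasible (s :: (l ++ [t]))) :
    P.HasCornerPath s t (polyLength (s :: (l ++ [t]))) := by
  induction l using List.reverseRecOn generalizing t with
  | nil => exact ⟨[], by simp, h, le_rfl⟩
  | append_singleton l a ih =>
    rw [isFeasible_cons_concat] at h
    rw [polyLength_cons_concat]
    simp only [List.getLastD_concat] at h ⊢
    exact (ih h.1).extend h.2

/-- Local star-shapedness joins nearby points by a segment, and connectedness chains these segments
together. -/
theorem exists_feasible {s t : Plane} (hs : s ∈ P.carrier) (ht : t ∈ P.carrier) :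
    ∃ l : List Plane, P.IsFeasible (s :: (l ++ [t])) := by
  refine P.isConnected.isPreconnected.induction₂'
    (fun x y => (∃ l : List Plane, P.IsFeasible (x :: (l ++ [y])))) (fun x hx => ?_) ?_ hs ht
  · obtain ⟨r, hr, hstar⟩ := P.exists_ball_starShaped hx
    filter_upwards [inter_mem_nhdsWithin _ (Metric.ball_mem_nhds x hr)] with y hy
    have := hstar y hy.1 hy.2
    exact ⟨⟨[], by simpa [IsFeasible] using this⟩,
      ⟨[], by simpa [IsFeasible, segment_symm ℝ y x] using this⟩⟩
  · rintro x y z _ _ _ ⟨l, hl⟩ ⟨l', hl'⟩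
    refine ⟨l ++ y :: l', ?_⟩
    have : x :: ((l ++ y :: l') ++ [z]) = (x :: l) ++ y :: (l' ++ [z]) := by simp
    rw [this]
    exact List.isChain_split.2 ⟨hl, hl'⟩

/-- Shortest paths exist, and they can be chosen to turn at corners only. -/
theorem exists_isShortestVia {s t : Plane} (hs : s ∈ P.carrier) (ht : t ∈ P.carrier) :
    ∃ c : List Plane, P.IsShortestVia s t c := by
  obtain ⟨l, hl⟩ := exists_feasible hs ht
  set N := {c : List Plane | (c.Nodup ∧ ∀ x ∈ c, x ∈ P.corners) ∧
    P.IsFeasible (s :: (c ++ [t]))} with hN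
  have hle : ∀ l : List Plane, P.IsFeasible (s :: (l ++ [t])) → ∃ c ∈ N,
      polyLength (s :: (c ++ [t])) ≤ polyLength (s :: (l ++ [t])) := by
    intro l hl
    obtain ⟨c, hc, hf, hcl⟩ := hl.hasCornerPath
    obtain ⟨c', hn, hsub, hf', hl'⟩ := exists_nodup_path hf
    exact ⟨c', ⟨⟨hn, fun x hx => hc x (hsub hx)⟩, hf'⟩, hl'.trans hcl⟩
  obtain ⟨c₀, hc₀, _⟩ := hle l hl
  obtain ⟨c, hc, hmin⟩ := Set.exists_min_image N (fun c => polyLength (s :: (c ++ [t])))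
    (P.finite_corners.finite_nodup_lists.subset fun c hc => hc.1) ⟨c₀, hc₀⟩
  refine ⟨c, hc.1.2, hc.2, le_antisymm ?_ (geodesicDist_le hc.2)⟩
  refine le_csInf ⟨_, l, hl, rfl⟩ ?_
  rintro _ ⟨l', hl', rfl⟩
  obtain ⟨c', hc', h⟩ := hle l' hl'
  exact (hmin c' hc').trans h

end PolygonalDomain

/-! ### The shortest path map -/

/-- A tangent direction of a circle, or one pointing outwards, leads out of the disk. -/
theorem dist_lt_dist_add_smul {v q d : Plane} {ε : ℝ} (hε : 0 < ε) (hd : d ≠ 0)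
    (h : inner ℝ d (v - q) ≤ 0) : dist v q < dist v (q + ε • d) := by
  rw [dist_eq_norm, dist_eq_norm]
  refine lt_of_pow_lt_pow_left₀ 2 (norm_nonneg _) ?_
  have heq : v - (q + ε • d) = (v - q) - ε • d := by abel
  rw [heq, norm_sub_sq_real (v - q), norm_smul, inner_smul_right, real_inner_comm,
    Real.norm_of_nonneg hε.le, mul_pow]
  have h1 : 0 < ε ^ 2 * ‖d‖ ^ 2 := by
    have := norm_pos_iff.2 hd
    positivity
  nlinarith

/-- Two closed half-planes with a common boundary point do not cover the plane. -/
theorem exists_ne_zero_inner_nonpos (a b : Plane) :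
    ∃ d : Plane, d ≠ 0 ∧ inner ℝ d a ≤ 0 ∧ inner ℝ d b ≤ 0 := by
  -- Being orthogonal to `a` leaves the sign of `d` free, and `b` decides it.
  obtain ⟨d, hd, hda⟩ : ∃ d : Plane, d ≠ 0 ∧ inner ℝ d a = 0 := by
    by_cases ha : a = 0
    · refine ⟨!₂[1, 0], fun h => ?_, by rw [ha, inner_zero_right]⟩
      have := congrFun (congrArg WithLp.ofLp h) 0
      simp at this
    · refine ⟨!₂[-a 1, a 0], fun h => ha ?_, ?_⟩
      · have h0 := congrFun (congrArg WithLp.ofLp h) 0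
        have h1 := congrFun (congrArg WithLp.ofLp h) 1
        simp only [Fin.isValue, Matrix.cons_val_zero, Matrix.cons_val_one, WithLp.ofLp_zero,
          Pi.zero_apply, neg_eq_zero] at h0 h1
        ext i
        fin_cases i
        exacts [h1, h0]
      · simp [PiLp.inner_apply, Fin.sum_univ_two]
        ring
  rcases le_total (inner ℝ d b) 0 with h | h
  · exact ⟨d, hd, hda.le, h⟩
  · exact ⟨-d, neg_ne_zero.2 hd, by rw [inner_neg_left, hda, neg_zero],
      by rw [inner_neg_left]; linarith⟩

namespace PolygonalDomain

variable {P : PolygonalDomain} {s : Plane}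

theorem geodesicDist_le_add (hs : s ∈ P.carrier) {v t : Plane}
    (h : segment ℝ v t ⊆ P.carrier) :
    P.geodesicDist s t ≤ P.geodesicDist s v + dist v t := by
  obtain ⟨c, _, hf, hl⟩ := exists_isShortestVia hs (h (left_mem_segment ℝ _ _))
  rw [← hl]
  have h1 : P.IsFeasible (s :: ((c ++ [v]) ++ [t])) :=
    (P.isFeasible_cons_concat).2 ⟨hf, by simpa using h⟩
  have h2 := geodesicDist_le h1
  rw [polyLength_cons_concat] at h2
  simpa using h2

/-- Replaces the existential over paths by a condition on `t` that is visibly closed. A last corner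
`v` splits the length at `v`; conversely, a shortest path to `v` is prolonged by the segment. -/
theorem mem_cell_iff (hs : s ∈ P.carrier) {v t : Plane} (hv : v ∈ P.sites s) :
    t ∈ P.cell s v ↔ segment ℝ v t ⊆ P.carrier ∧
      P.geodesicDist s t = P.geodesicDist s v + dist v t := by
  constructor
  · rintro ⟨c, ⟨hc, hf, hl⟩, hlast⟩
    rw [isFeasible_cons_concat, hlast] at hf
    rw [polyLength_cons_concat, hlast] at hl
    refine ⟨hf.2, le_antisymm (geodesicDist_le_add hs hf.2) ?_⟩
    rw [← hl]
    gcongr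
    rcases List.eq_nil_or_concat c with rfl | ⟨c', w, rfl⟩
    · rw [List.getLastD_nil] at hlast
      rw [← hlast, geodesicDist_self hs]
      exact polyLength_nonneg _
    · rw [List.concat_eq_append] at hlast hf ⊢
      rw [List.getLastD_concat] at hlast
      rw [hlast] at hf ⊢
      exact geodesicDist_le hf.1
  · rintro ⟨hseg, h⟩
    -- The source need not be a corner, so its cell is witnessed by the empty corner list.
    by_cases hvs : v = s
    · subst hvs
      refine ⟨[], ⟨by simp, by simpa [IsFeasible] using hseg, ?_⟩, rfl⟩
      rw [h, geodesicDist_self hs]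
      simp [polyLength]
    · have hvc : v ∈ P.corners := (mem_insert_iff.1 hv).resolve_left hvs
      obtain ⟨c, hc, hf, hl⟩ := exists_isShortestVia hs (P.corners_subset hvc)
      refine ⟨c ++ [v], ⟨fun x hx => ?_, ?_, ?_⟩, List.getLastD_concat⟩
      · rcases List.mem_append.1 hx with hx | hx
        · exact hc x hx
        · rwa [List.mem_singleton.1 hx]
      · exact (P.isFeasible_cons_concat).2 ⟨hf, by simpa using hseg⟩
      · rw [polyLength_cons_concat, hl, List.getLastD_concat, h]

theorem exists_mem_cell (hs : s ∈ P.carrier) {t : Plane} (ht : t ∈ P.carrier) :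
    ∃ v ∈ P.sites s, t ∈ P.cell s v := by
  obtain ⟨c, hc⟩ := exists_isShortestVia hs ht
  refine ⟨c.getLastD s, ?_, c, hc, rfl⟩
  by_cases h : c.getLastD s = s
  · exact Or.inl h
  · exact Or.inr (hc.1 _ (List.mem_of_getLastD_ne rfl h))

/-- Near `x`, star-shapedness gives a segment from `x` to `y`, so the two distances differ by at
most `dist x y`. -/
theorem continuousOn_geodesicDist (hs : s ∈ P.carrier) :
    ContinuousOn (P.geodesicDist s) P.carrier := by
  intro x hx
  obtain ⟨r, hr, hstar⟩ := P.exists_ball_starShaped hx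
  rw [Metric.continuousWithinAt_iff]
  refine fun ε hε => ⟨min r ε, lt_min hr hε, fun {y} hy hyx => ?_⟩
  have hseg := hstar y hy (Metric.mem_ball.2 (hyx.trans_le (min_le_left _ _)))
  have h1 := geodesicDist_le_add hs hseg
  have h2 := geodesicDist_le_add hs (segment_symm ℝ x y ▸ hseg)
  rw [dist_comm x y] at h1
  have h3 := hyx.trans_le (min_le_right r ε)
  rw [Real.dist_eq, abs_lt]
  constructor <;> linarith

theorem isClosed_cell (hs : s ∈ P.carrier) {v : Plane} (hv : v ∈ P.sites s) :
    IsClosed (P.cell s v) := by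
  have hsub : {t | segment ℝ v t ⊆ P.carrier} ⊆ P.carrier := fun t ht =>
    ht (right_mem_segment ℝ _ _)
  have h : P.cell s v = {t | segment ℝ v t ⊆ P.carrier} ∩
      (fun t => P.geodesicDist s t - (P.geodesicDist s v + dist v t)) ⁻¹' {0} := by
    ext t
    rw [mem_cell_iff hs hv, mem_inter_iff, mem_preimage, mem_singleton_iff, sub_eq_zero]
    rfl
  rw [h]
  refine ContinuousOn.preimage_isClosed_of_isClosed ?_
    (isClosed_setOf_segment_subset P.isClosed_carrier v) isClosed_singleton
  exact ((continuousOn_geodesicDist hs).mono hsub).sub (by fun_prop)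

theorem closure_face_subset (hs : s ∈ P.carrier) {v : Plane} (hv : v ∈ P.sites s) :
    closure (P.face s v) ⊆ P.cell s v :=
  closure_minimal interior_subset (isClosed_cell hs hv)

theorem face_subset_interior (hs : s ∈ P.carrier) {v : Plane} (hv : v ∈ P.sites s) :
    P.face s v ⊆ interior P.carrier :=
  interior_mono fun _ ht => ((mem_cell_iff hs hv).1 ht).1 (right_mem_segment ℝ _ _)

/-- The faces are dense in the domain. -/
theorem exists_face_inter_nonempty (hs : s ∈ P.carrier) {O : Set Plane} (hO : IsOpen O)
    (hne : (O ∩ P.carrier).Nonempty) : ∃ v ∈ P.sites s, (O ∩ P.face s v).Nonempty := by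
  -- Baire category: the cells and the complement of the interior (index `none`) are finitely many
  -- closed sets covering the plane, so their interiors are jointly dense.
  have hdense : Dense (⋃ i ∈ (insert none (some '' P.sites s) : Set (Option Plane)),
      interior (i.elim (interior P.carrier)ᶜ (P.cell s))) := by
    refine dense_biUnion_interior_of_closed ?_ (((P.finite_sites s).image some).insert _).countable ?_
    · rintro _ (rfl | ⟨v, hv, rfl⟩)
      · exact isOpen_interior.isClosed_compl
      · exact isClosed_cell hs hv
    · refine eq_univ_of_forall fun t => ?_
      by_cases ht : t ∈ interior P.carrier
      · obtain ⟨v, hv, htv⟩ := exists_mem_cell hs (interior_subset ht)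
        exact mem_biUnion (Or.inr ⟨v, hv, rfl⟩) htv
      · exact mem_biUnion (Or.inl rfl) ht
  have hne' : (O ∩ interior P.carrier).Nonempty := by
    obtain ⟨t, htO, ht⟩ := hne
    rw [← P.closure_interior] at ht
    exact mem_closure_iff.1 ht O hO htO
  obtain ⟨t, ⟨htO, htP⟩, ht⟩ := hdense.inter_open_nonempty _ (hO.inter isOpen_interior) hne'
  obtain ⟨i, hi, hti⟩ := mem_iUnion₂.1 ht
  rcases hi with rfl | ⟨v, hv, rfl⟩
  · exact absurd htP (interior_subset hti)
  · exact ⟨v, hv, t, htO, hti⟩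

/-- The sites whose faces accumulate at `q`. -/
def incidentSites (P : PolygonalDomain) (s q : Plane) : Set Plane :=
  {v | v ∈ P.sites s ∧ q ∈ closure (P.face s v)}

/-- Near `q`, the domain is covered by the closures of the faces that accumulate at `q`. -/
theorem exists_ball_subset_iUnion_incidentSites (hs : s ∈ P.carrier) (q : Plane) :
    ∃ r > 0, ∀ t ∈ P.carrier, t ∈ Metric.ball q r →
      ∃ v ∈ P.incidentSites s q, t ∈ closure (P.face s v) := by
  have hfin : {v | v ∈ P.sites s ∧ q ∉ closure (P.face s v)}.Finite :=
    (P.finite_sites s).subset fun v hv => hv.1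
  have hclosed : IsClosed (⋃ v ∈ {v | v ∈ P.sites s ∧ q ∉ closure (P.face s v)},
      closure (P.face s v)) := hfin.isClosed_biUnion fun v _ => isClosed_closure
  obtain ⟨r, hr, hball⟩ := Metric.isOpen_iff.1 hclosed.isOpen_compl q fun h => by
    obtain ⟨v, hv, hq⟩ := mem_iUnion₂.1 h
    exact hv.2 hq
  refine ⟨r, hr, fun t ht htb => ?_⟩
  have hTfin : (P.incidentSites s q).Finite := (P.finite_sites s).subset fun v hv => hv.1
  suffices h : t ∈ closure (⋃ v ∈ P.incidentSites s q, P.face s v) by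
    rw [hTfin.closure_biUnion] at h
    simpa using h
  rw [mem_closure_iff]
  intro O hO htO
  obtain ⟨v, hv, x, ⟨hxO, hxb⟩, hx⟩ := exists_face_inter_nonempty hs
    (hO.inter Metric.isOpen_ball) ⟨t, ⟨htO, htb⟩, ht⟩
  refine ⟨x, hxO, mem_biUnion ⟨hv, ?_⟩ hx⟩
  by_contra hq
  exact hball hxb (mem_biUnion ⟨hv, hq⟩ (subset_closure hx))

/-- Near a farthest neighbor `q`, every point is at most as far as `q` from some incident site. -/
theorem IsFarthestNeighbor.exists_ball_dist_le (hs : s ∈ P.carrier) {q : Plane}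
    (hq : P.IsFarthestNeighbor s q) : ∃ r > 0, ∀ t ∈ P.carrier, t ∈ Metric.ball q r →
      ∃ v ∈ P.incidentSites s q, dist v t ≤ dist v q := by
  obtain ⟨r, hr, h⟩ := exists_ball_subset_iUnion_incidentSites hs q
  refine ⟨r, hr, fun t ht htb => ?_⟩
  obtain ⟨v, hv, htv⟩ := h t ht htb
  refine ⟨v, hv, ?_⟩
  -- Both distances from `s` decompose through the same `v`, so maximality at `q` compares the
  -- Euclidean parts.
  have h1 := ((mem_cell_iff hs hv.1).1 (closure_face_subset hs hv.1 htv)).2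
  have h2 := ((mem_cell_iff hs hv.1).1 (closure_face_subset hs hv.1 hv.2)).2
  linarith [hq.2 t ht]

/-- The sites incident to a farthest neighbor do not all lie in the half-plane behind a feasible
direction. -/
theorem IsFarthestNeighbor.exists_inner_pos (hs : s ∈ P.carrier) {q : Plane}
    (hq : P.IsFarthestNeighbor s q) {d : Plane} (hd : d ≠ 0) {ε₀ : ℝ} (hε₀ : 0 < ε₀)
    (hsub : ∀ ε, 0 < ε → ε < ε₀ → q + ε • d ∈ P.carrier) :
    ∃ v ∈ P.incidentSites s q, 0 < inner ℝ d (v - q) := by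
  obtain ⟨r, hr, h⟩ := hq.exists_ball_dist_le hs
  have hdn : 0 < ‖d‖ := norm_pos_iff.2 hd
  set ε := min (ε₀ / 2) (r / (2 * ‖d‖)) with hε
  have hε0 : 0 < ε := lt_min (by positivity) (by positivity)
  have hεd : ε * ‖d‖ < r := by
    calc ε * ‖d‖ ≤ r / (2 * ‖d‖) * ‖d‖ := by gcongr; exact min_le_right _ _
      _ = r / 2 := by field_simp
      _ < r := by linarith
  obtain ⟨v, hv, hle⟩ := h (q + ε • d)
    (hsub ε hε0 (by linarith [min_le_left (ε₀ / 2) (r / (2 * ‖d‖))]))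
    (by rwa [mem_ball_iff_norm, add_sub_cancel_left, norm_smul, Real.norm_of_nonneg hε0.le])
  exact ⟨v, hv, not_le.1 fun h' => (dist_lt_dist_add_smul hε0 hd h').not_ge hle⟩

/-- A farthest neighbor in the interior is incident to more than two faces. -/
theorem IsFarthestNeighbor.exists_third_of_mem_interior (hs : s ∈ P.carrier) {q : Plane}
    (hq : P.IsFarthestNeighbor s q) (hqi : q ∈ interior P.carrier) (v w : Plane) :
    ∃ u ∈ P.incidentSites s q, u ≠ v ∧ u ≠ w := by
  obtain ⟨d, hd, hdv, hdw⟩ := exists_ne_zero_inner_nonpos (v - q) (w - q)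
  obtain ⟨r, hr, hball⟩ := Metric.mem_nhds_iff.1 (mem_interior_iff_mem_nhds.1 hqi)
  have hdn : 0 < ‖d‖ := norm_pos_iff.2 hd
  obtain ⟨u, hu, hpos⟩ := hq.exists_inner_pos hs hd (ε₀ := r / ‖d‖) (by positivity)
    fun ε hε hlt => hball (by
      rw [mem_ball_iff_norm, add_sub_cancel_left, norm_smul, Real.norm_of_nonneg hε.le]
      exact (lt_div_iff₀ hdn).1 hlt)
  exact ⟨u, hu, by rintro rfl; linarith, by rintro rfl; linarith⟩

/-- A farthest neighbor in the relative interior of a boundary edge is incident to more than one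
face. -/
theorem IsFarthestNeighbor.exists_second_of_mem_frontier (hs : s ∈ P.carrier) {q : Plane}
    (hq : P.IsFarthestNeighbor s q) (hqf : q ∈ frontier P.carrier) (hqc : q ∉ P.corners)
    (v : Plane) : ∃ w ∈ P.incidentSites s q, w ≠ v := by
  obtain ⟨A, B, hAB, hqs, hsub, -⟩ := P.exists_edge_of_mem_frontier hqf hqc
  rw [openSegment_eq_image'] at hqs
  obtain ⟨m, hm, rfl⟩ := hqs
  simp only at hq hqf hqc ⊢
  have hd : B - A ≠ 0 := sub_ne_zero.2 (Ne.symm hAB)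
  have hmem : ∀ x ∈ Icc (0 : ℝ) 1, A + x • (B - A) ∈ P.carrier := fun x hx =>
    P.frontier_subset (hsub (by
      rw [segment_eq_image']
      exact ⟨x, hx, rfl⟩))
  -- Both directions along the edge are feasible; the one with nonpositive inner product with `v -
  -- q` excludes `v`.
  rcases le_total (inner ℝ (B - A) (v - (A + m • (B - A)))) 0 with h | h
  · obtain ⟨w, hw, hpos⟩ := hq.exists_inner_pos hs hd (ε₀ := 1 - m) (by linarith [hm.2])
      fun ε hε hlt => by
        have := hmem (m + ε) ⟨by linarith [hm.1], by linarith⟩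
        rwa [add_smul, ← add_assoc] at this
    exact ⟨w, hw, by rintro rfl; linarith⟩
  · obtain ⟨w, hw, hpos⟩ := hq.exists_inner_pos hs (neg_ne_zero.2 hd) (ε₀ := m) hm.1
      fun ε hε hlt => by
        have := hmem (m - ε) ⟨by linarith, by linarith [hm.2]⟩
        rwa [sub_smul, sub_eq_add_neg, ← smul_neg, ← add_assoc] at this
    rw [inner_neg_left] at hpos
    exact ⟨w, hw, by rintro rfl; linarith⟩

/-- If exactly two faces accumulate at a point which is not a corner, then so does the edge between
them. -/
theorem mem_closure_edge (hs : s ∈ P.carrier) {q v w : Plane} (hq : q ∈ P.carrier)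
    (hqc : q ∉ P.corners) (hv : v ∈ P.incidentSites s q) (hw : w ∈ P.incidentSites s q)
    (hvw : ∀ u ∈ P.incidentSites s q, u = v ∨ u = w) : q ∈ closure (P.edge s v w) := by
  obtain ⟨r, hr, hcov⟩ := exists_ball_subset_iUnion_incidentSites hs q
  obtain ⟨r', hr', hconv⟩ := P.exists_ball_convex hq hqc
  rw [Metric.mem_closure_iff]
  intro ε hε
  set ρ := min ε (min r r') with hρ
  have hρ0 : 0 < ρ := lt_min hε (lt_min hr hr')
  have hconvex : Convex ℝ (interior P.carrier ∩ Metric.ball q ρ) := by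
    have h1 := hconv.interior.inter (convex_ball q ρ)
    rw [interior_inter, Metric.isOpen_ball.interior_eq, inter_assoc,
      inter_eq_self_of_subset_right
        (Metric.ball_subset_ball ((min_le_right _ _).trans (min_le_right _ _)))] at h1
    exact h1
  have hmeet : ∀ u ∈ P.incidentSites s q,
      ((interior P.carrier ∩ Metric.ball q ρ) ∩ closure (P.face s u)).Nonempty := by
    rintro u ⟨hu, hqu⟩
    obtain ⟨x, hxb, hx⟩ := mem_closure_iff.1 hqu _ Metric.isOpen_ball (Metric.mem_ball_self hρ0)
    exact ⟨x, ⟨face_subset_interior hs hu hx, hxb⟩, subset_closure hx⟩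
  -- A connected set covered by two closed sets that both meet it contains a common point of them.
  obtain ⟨x, ⟨hxi, hxb⟩, hxv, hxw⟩ := isPreconnected_closed_iff.1 hconvex.isPreconnected
    _ _ isClosed_closure isClosed_closure (fun x hx => by
      obtain ⟨u, hu, hxu⟩ := hcov x (interior_subset hx.1)
        (Metric.ball_subset_ball ((min_le_right _ _).trans (min_le_left _ _)) hx.2)
      rcases hvw u hu with rfl | rfl
      exacts [Or.inl hxu, Or.inr hxu]) (hmeet v hv) (hmeet w hw)
  refine ⟨x, ⟨⟨hxv, hxw⟩, hxi⟩, ?_⟩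
  rw [dist_comm]
  exact (Metric.mem_ball.1 hxb).trans_le (min_le_left _ _)

end PolygonalDomain

theorem lemma1 (P : PolygonalDomain) (p : Plane) (hp : p ∈ P.carrier) (q : Plane)
    (hq : P.IsFarthestNeighbor p q) : q ∈ P.spmVertices p := by
  by_cases hqc : q ∈ P.corners
  · exact Or.inl hqc
  right
  by_cases hqi : q ∈ interior P.carrier
  · right
    -- The arguments `q q` are dummies; the three calls avoid no, one and two earlier sites.
    obtain ⟨u, hu, -, -⟩ := hq.exists_third_of_mem_interior hp hqi q q
    obtain ⟨v, hv, hvu, -⟩ := hq.exists_third_of_mem_interior hp hqi u u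
    obtain ⟨w, hw, hwu, hwv⟩ := hq.exists_third_of_mem_interior hp hqi u v
    exact ⟨u, hu.1, v, hv.1, w, hw.1, hvu.symm, hwu.symm, hwv.symm, hu.2, hv.2, hw.2⟩
  have hqf : q ∈ frontier P.carrier := ⟨subset_closure hq.1, hqi⟩
  obtain ⟨v, hv, -⟩ := hq.exists_second_of_mem_frontier hp hqf hqc q
  obtain ⟨w, hw, hwv⟩ := hq.exists_second_of_mem_frontier hp hqf hqc v
  by_cases h : ∃ u ∈ P.incidentSites p q, u ≠ v ∧ u ≠ w
  · obtain ⟨u, hu, huv, huw⟩ := h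
    exact Or.inr ⟨u, hu.1, v, hv.1, w, hw.1, huv, huw, hwv.symm, hu.2, hv.2, hw.2⟩
  · push Not at h
    refine Or.inl ⟨hqf, v, hv.1, w, hw.1, hwv.symm,
      PolygonalDomain.mem_closure_edge hp hq.1 hqc hv hw ?_⟩
    intro u hu
    by_cases huv : u = v
    · exact Or.inl huv
    · exact Or.inr (h u hu huv)
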